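/- Let $\Sigma$ be a finite alphabet. A function on strings (or on pairs of strings, or with values in $\{0,1\}$) is called polynomial-time computable if some deterministic multi-tape Turing machine computes it and halts within a number of steps bounded by a polynomial in the length of the input. A set $L \subseteq \Sigma^*$ is in $\mathrm{P}$ if its characteristic function is polynomial-time computable. A set $L \subseteq \Sigma^*$ is $\mathrm{P}$-selective if there is a polynomial-time computable function $f : \Sigma^* \times \Sigma^* \to \Sigma^*$ such that $$(\forall a, b \in \Sigma^*)\bigl[\, f(a,b) \in \{a,b\} \ \wedge\ \bigl(\{a,b\} \cap L \neq \emptyset \implies f(a,b) \in L\bigr)\bigr].$$ Propositional Boolean formulas are built from the constants $\mathrm{True}$ and $\mathrm{False}$ and variables $x_w$ (where $w \in \{0,1\}^*$) by $\neg$, $\wedge$ and $\vee$. They are written as strings over the finite alphabet $\{\mathrm{True}, \mathrm{False}, x, 0, 1, \neg, \wedge, \vee\}$ in prefix notation, the variable $x_w$ being written as $x$ followed by the digits of $w$. Let $\mathrm{SAT}$ be the set of all strings that are satisfiable propositional Boolean formulas, i.e. formulas that evaluate to $\mathrm{True}$ under some assignment of truth values to their variables. **Theorem (Selman).** If $\mathrm{SAT}$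 is $\mathrm{P}$-selective, then $\mathrm{SAT} \in \mathrm{P}$. -/

import Mathlib

namespace Complexity

/-- A function `f` between types whose objects are represented by strings is polynomial-time
computable: some multi-stack Turing machine, started on the representation of `a`, halts with the
representation of `f a` as its output, within a number of steps that is bounded by a polynomial in
the length of the representation of `a`. -/
def PolyTimeComputable {α β A B : Type} (ea : Computability.Encoding α A)
    (eb : Computability.Encoding β B) (f : α → β) : Prop :=
  Nonempty (Turing.TM2ComputableInPolyTime ea.encode eb.encode f)

/-- Strings over `A`, represented by themselves. -/
abbrev stringEncoding (A : Type) : Computability.Encoding (List A) A :=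
  Computability.encodingList A

/-- Pairs of strings over `A`, represented by the two strings one after the other, each symbol
being marked with the component that it comes from. -/
abbrev stringPairEncoding (A : Type) : Computability.Encoding (List A × List A) (A ⊕ A) :=
  Computability.encodingProd (stringEncoding A) (stringEncoding A)

/-- `L ∈ P`: the membership problem of `L` is decided by a polynomial-time machine, which answers
with one bit. -/
def InP {A : Type} (L : Language A) : Prop :=
  ∃ χ : List A → Bool,
    PolyTimeComputable (stringEncoding A) Computability.encodingBoolBool χ ∧
      ∀ x, χ x = true ↔ x ∈ L

/-- `L` is P-selective. -/
def PSelective {A : Type} (L : Language A) : Prop :=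
  ∃ f : List A × List A → List A,
    PolyTimeComputable (stringPairEncoding A) (stringEncoding A) f ∧
      ∀ a b : List A,
        f (a, b) ∈ ({a, b} : Set (List A)) ∧
          ((({a, b} : Set (List A)) ∩ {x | x ∈ L}).Nonempty → f (a, b) ∈ L)

/-- Propositional Boolean formulas with the constants true and false. The variables are the `x_w`
for `w` a binary string. -/
inductive BoolFormula : Type
  | const : Bool → BoolFormula
  | var : List Bool → BoolFormula
  | not : BoolFormula → BoolFormula
  | and : BoolFormula → BoolFormula → BoolFormula
  | or : BoolFormula → BoolFormula → BoolFormula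

namespace BoolFormula

/-- The truth value of a formula under an assignment of truth values to the variables. -/
def eval (v : List Bool → Bool) : BoolFormula → Bool
  | const b => b
  | var w => v w
  | not F => !(eval v F)
  | and F G => eval v F && eval v G
  | or F G => eval v F || eval v G

/-- Some assignment makes the formula true. -/
def Satisfiable (F : BoolFormula) : Prop :=
  ∃ v : List Bool → Bool, F.eval v = true

/-- The eight symbols in which formulas are written: the two truth constants, the letter `x`, the
two binary digits of variable names, and the three connectives. -/
inductive Symbol : Type
  | const : Bool → Symbol
  | x : Symbol
  | digit : Bool → Symbol
  | not : Symbol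
  | and : Symbol
  | or : Symbol
  deriving DecidableEq, Fintype

/-- A formula as a string, in prefix (Polish) notation. The variable `x_w` is written as the letter
`x` followed by the digits of `w`. -/
def write : BoolFormula → List Symbol
  | const b => [Symbol.const b]
  | var w => Symbol.x :: w.map Symbol.digit
  | not F => Symbol.not :: write F
  | and F G => Symbol.and :: (write F ++ write G)
  | or F G => Symbol.or :: (write F ++ write G)

end BoolFormula

/-- SAT: the set of the strings that are satisfiable Boolean formulas. -/
def SAT : Language BoolFormula.Symbol :=
  {s | ∃ F : BoolFormula, F.Satisfiable ∧ F.write = s}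

end Complexity

/-! SAT is self-reducible: a formula with a variable `x_w` is satisfiable iff one of its two
instances, with `x_w` false or true, is. A selector applied to these instances returns one of them,
and returns a satisfiable one if there is one, so its value is satisfiable iff the formula is.
Iterating this removes all variables without ever branching, and the remaining constant formula is
evaluated.

The reduction is carried out on arbitrary strings, so no syntax check is needed beforehand. A
right-to-left stack evaluation characterises SAT (`mem_SAT_iff_evalString`), and substitution
commutes with it even on malformed strings, which gives `mem_SAT_iff_substString`. A round never
lengthens the string (`length_substString_le`) and lowers the number of letters `x`
(`count_substString_lt`). Hence there are at most linearly many rounds, each with a selector call on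
two strings no longer than the original input, and the total time is polynomial.

The rest realises this loop on a machine that contains the selector machine and replaces its halting
by a jump back to the start of the loop. `goes_subst` is the main invariant, `goes_round` times one
round, and `answers_find` is the induction over rounds. -/

namespace Complexity

open BoolFormula

/-! ### Substitution and evaluation on strings -/

/-- The digits with which a string begins. -/
def leadDigits : List Symbol → List Bool
  | .digit d :: s => d :: leadDigits s
  | _ => []

/-- The name of the first variable that occurs in a string. -/
def firstVar : List Symbol → Option (List Bool)
  | [] => none
  | a :: s => if a = .x then some (leadDigits s) else firstVar s

/-- The string `s` without its leading digits, with `b` substituted for the variable `x_w`. -/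
def substRest (w : List Bool) (b : Bool) : List Symbol → List Symbol
  | [] => []
  | .digit _ :: s => substRest w b s
  | a :: s =>
    if a = .x ∧ leadDigits s = w then .const b :: substRest w b s
    else a :: ((leadDigits s).map .digit ++ substRest w b s)

/-- The string `s` with the constant `b` substituted for the variable `x_w`. -/
def substString (w : List Bool) (b : Bool) (s : List Symbol) : List Symbol :=
  (leadDigits s).map .digit ++ substRest w b s

/-- The effect of a constant or a connective on a stack of truth values. -/
def applySymbol : Symbol → List Bool → Option (List Bool)
  | .const c, st => some (c :: st)
  | .not, b :: st => some ((!b) :: st)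
  | .and, b :: c :: st => some ((b && c) :: st)
  | .or, b :: c :: st => some ((b || c) :: st)
  | _, _ => none

/-- The values of the formulas that `s` consists of after its leading digits. -/
def evalRest (v : List Bool → Bool) : List Symbol → Option (List Bool)
  | [] => some []
  | .digit _ :: s => evalRest v s
  | .x :: s => (evalRest v s).map (v (leadDigits s) :: ·)
  | a :: s => if leadDigits s = [] then (evalRest v s).bind (applySymbol a) else none

/-- The values of the formulas that `s` consists of, if it is a sequence of formulas. -/
def evalString (v : List Bool → Bool) (s : List Symbol) : Option (List Bool) :=
  if leadDigits s = [] then evalRest v s else none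

/-- The values of the formulas without variables that `s` consists of. -/
def evalConst : List Symbol → Option (List Bool)
  | [] => some []
  | a :: s => (evalConst s).bind (applySymbol a)

@[simp]
theorem leadDigits_write_append (F : BoolFormula) (t : List Symbol) :
    leadDigits (F.write ++ t) = [] := by
  cases F <;> simp [write, leadDigits]

@[simp]
theorem leadDigits_digits_append (u : List Bool) (t : List Symbol) :
    leadDigits (u.map Symbol.digit ++ t) = u ++ leadDigits t := by
  induction u with
  | nil => rfl
  | cons d u ih => simp [leadDigits, ih]

@[simp]
theorem evalRest_digits_append (v : List Bool → Bool) (u : List Bool) (t : List Symbol) :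
    evalRest v (u.map Symbol.digit ++ t) = evalRest v t := by
  induction u with
  | nil => rfl
  | cons d u ih => simp [evalRest, ih]

theorem evalRest_write_append (v : List Bool → Bool) (F : BoolFormula) (t : List Symbol)
    (ht : leadDigits t = []) :
    evalRest v (F.write ++ t) = (evalRest v t).map (F.eval v :: ·) := by
  induction F generalizing t with
  | const b => cases h : evalRest v t <;> simp [write, evalRest, ht, h, applySymbol, eval]
  | var w => simp [write, evalRest, ht, eval]
  | not F ih =>
    cases h : evalRest v t <;> simp [write, evalRest, ih t ht, h, applySymbol, eval]
  | and F G ihF ihG =>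
    cases h : evalRest v t <;>
      simp [write, evalRest, ihG t ht, ihF _ (leadDigits_write_append G t), h, applySymbol, eval]
  | or F G ihF ihG =>
    cases h : evalRest v t <;>
      simp [write, evalRest, ihG t ht, ihF _ (leadDigits_write_append G t), h, applySymbol, eval]

/-- Converse of `evalRest_write_append`: a successful evaluation already determines a parse. A
connective finds its operands on the stack only if the string to its right begins with that many
formulas. -/
theorem exists_formulas_of_evalRest (v : List Bool → Bool) (s : List Symbol) (st : List Bool)
    (h : evalRest v s = some st) :
    ∃ Fs : List BoolFormula,
      s = (leadDigits s).map Symbol.digit ++ (Fs.map write).flatten ∧ Fs.map (eval v) = st := by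
  induction s generalizing st with
  | nil =>
    obtain rfl : [] = st := by simpa [evalRest] using h
    exact ⟨[], rfl, rfl⟩
  | cons a s ih =>
    cases a with
    | digit d =>
      obtain ⟨Fs, h1, h2⟩ := ih st h
      exact ⟨Fs, by simpa [leadDigits] using h1, h2⟩
    | x =>
      obtain ⟨st', h', rfl⟩ := Option.map_eq_some_iff.1 h
      obtain ⟨Fs, h1, h2⟩ := ih st' h'
      exact ⟨.var (leadDigits s) :: Fs, by simpa [leadDigits, write] using h1, by simp [h2, eval]⟩
    | const c =>
      simp only [evalRest, Option.ite_none_right_eq_some, Option.bind_eq_some_iff] at h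
      obtain ⟨hs, st', h', h3⟩ := h
      obtain ⟨Fs, h1, h2⟩ := ih st' h'
      obtain rfl : c :: st' = st := by simpa [applySymbol] using h3
      exact ⟨.const c :: Fs, by simpa [leadDigits, write, hs] using h1, by simp [h2, eval]⟩
    | not =>
      simp only [evalRest, Option.ite_none_right_eq_some, Option.bind_eq_some_iff] at h
      obtain ⟨hs, st', h', h3⟩ := h
      obtain ⟨Fs, h1, h2⟩ := ih st' h'
      rcases Fs with _ | ⟨F, Fs⟩ <;> subst h2 <;> simp [applySymbol] at h3
      exact ⟨.not F :: Fs, by simpa [leadDigits, write, hs] using h1, by simp [← h3, eval]⟩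
    | and =>
      simp only [evalRest, Option.ite_none_right_eq_some, Option.bind_eq_some_iff] at h
      obtain ⟨hs, st', h', h3⟩ := h
      obtain ⟨Fs, h1, h2⟩ := ih st' h'
      rcases Fs with _ | ⟨F, _ | ⟨G, Fs⟩⟩ <;> subst h2 <;> simp [applySymbol] at h3
      exact ⟨.and F G :: Fs, by simpa [leadDigits, write, hs] using h1, by simp [← h3, eval]⟩
    | or =>
      simp only [evalRest, Option.ite_none_right_eq_some, Option.bind_eq_some_iff] at h
      obtain ⟨hs, st', h', h3⟩ := h
      obtain ⟨Fs, h1, h2⟩ := ih st' h'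
      rcases Fs with _ | ⟨F, _ | ⟨G, Fs⟩⟩ <;> subst h2 <;> simp [applySymbol] at h3
      exact ⟨.or F G :: Fs, by simpa [leadDigits, write, hs] using h1, by simp [← h3, eval]⟩

theorem mem_SAT_iff_evalString (s : List Symbol) :
    s ∈ SAT ↔ ∃ v, evalString v s = some [true] := by
  constructor
  · rintro ⟨F, ⟨v, hv⟩, rfl⟩
    refine ⟨v, ?_⟩
    have h1 := evalRest_write_append v F [] rfl
    have h2 := leadDigits_write_append F []
    rw [List.append_nil] at h1 h2
    simp [evalString, h1, h2, evalRest, hv]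
  · rintro ⟨v, hv⟩
    simp only [evalString, Option.ite_none_right_eq_some] at hv
    obtain ⟨Fs, h1, h2⟩ := exists_formulas_of_evalRest v s _ hv.2
    obtain ⟨F, rfl, hF⟩ := List.map_eq_singleton_iff.1 h2
    exact ⟨F, ⟨v, hF⟩, by simpa [hv.1] using h1.symm⟩

@[simp]
theorem leadDigits_substRest (w : List Bool) (b : Bool) (s : List Symbol) :
    leadDigits (substRest w b s) = [] := by
  fun_induction substRest w b s with
  | case1 => rfl
  | case2 _ _ ih => exact ih
  | case3 => rfl
  | case4 a s h => cases a <;> simp_all [leadDigits]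

@[simp]
theorem leadDigits_substString (w : List Bool) (b : Bool) (s : List Symbol) :
    leadDigits (substString w b s) = leadDigits s := by
  simp [substString]

/-- Replacing an occurrence of `x_w` also deletes its digits, so the new constant is not followed by
a digit and evaluates without error; all other symbols keep their digits, and hence their errors. -/
theorem evalRest_substRest (v : List Bool → Bool) (w : List Bool) (b : Bool) (s : List Symbol) :
    evalRest v (substRest w b s) = evalRest (Function.update v w b) s := by
  induction s with
  | nil => rfl
  | cons a s ih =>
    cases a with
    | digit d => exact ih
    | x =>
      by_cases h : leadDigits s = w
      · cases h' : evalRest (Function.update v w b) s <;>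
          simp [substRest, evalRest, h, ih, h', applySymbol]
      · simp [substRest, evalRest, h, ih]
    | _ => simp [substRest, evalRest, ih]

theorem evalString_substString (v : List Bool → Bool) (w : List Bool) (b : Bool)
    (s : List Symbol) :
    evalString v (substString w b s) = evalString (Function.update v w b) s := by
  simp only [evalString, leadDigits_substString]
  rw [substString, evalRest_digits_append, evalRest_substRest]

theorem mem_SAT_iff_substString (w : List Bool) (s : List Symbol) :
    s ∈ SAT ↔ substString w false s ∈ SAT ∨ substString w true s ∈ SAT := by
  simp only [mem_SAT_iff_evalString, evalString_substString]
  constructor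
  · rintro ⟨v, hv⟩
    -- A satisfying `v` is its own update at `w` by the value `v w`, which says which instance it
    -- satisfies.
    cases h : v w <;> rw [← Function.update_eq_self w v, h] at hv
    · exact .inl ⟨v, hv⟩
    · exact .inr ⟨v, hv⟩
  · rintro (⟨v, hv⟩ | ⟨v, hv⟩) <;> exact ⟨_, hv⟩

theorem length_substString_le (w : List Bool) (b : Bool) (s : List Symbol) :
    (substString w b s).length ≤ s.length := by
  induction s with
  | nil => rfl
  | cons a s ih =>
    simp only [substString, List.length_append, List.length_map] at ih ⊢
    cases a <;> simp only [substRest, leadDigits] <;> try split_ifs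
    all_goals (simp; omega)

theorem count_substString (w : List Bool) (b : Bool) (s : List Symbol) :
    (substString w b s).count .x = (substRest w b s).count .x := by
  simp [substString, List.count_eq_zero]

theorem count_substRest_le (w : List Bool) (b : Bool) (s : List Symbol) :
    (substRest w b s).count .x ≤ s.count .x := by
  induction s with
  | nil => rfl
  | cons a s ih =>
    have h := count_substString w b s
    simp only [substString] at h
    cases a <;> simp only [substRest] <;> try split_ifs
    all_goals simp_all <;> omega

/-- The name comes from the first `x` of the string, so at least that occurrence disappears. This
bounds the number of rounds. -/
theorem count_substString_lt (w : List Bool) (b : Bool) (s : List Symbol)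
    (hw : firstVar s = some w) : (substString w b s).count .x < s.count .x := by
  rw [count_substString]
  induction s with
  | nil => simp [firstVar] at hw
  | cons a s ih =>
    have h := count_substString w b s
    have h' := count_substRest_le w b s
    simp only [substString] at h
    cases a <;> simp only [substRest, firstVar] at hw ⊢
    all_goals simp_all

theorem length_firstVar_le (w : List Bool) (s : List Symbol) (hw : firstVar s = some w) :
    w.length ≤ s.length := by
  have key : ∀ s, (leadDigits s).length ≤ s.length := by
    intro s
    induction s with
    | nil => rfl
    | cons a s ih => cases a <;> simp [leadDigits, ih]
  induction s with
  | nil => simp [firstVar] at hw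
  | cons a s ih =>
    have := key s
    simp only [firstVar] at hw
    split_ifs at hw
    · obtain rfl := Option.some.inj hw
      simp; omega
    · have := ih hw
      simp; omega

/-- Without the letter `x` every digit is an error. One evaluation fails at the digit itself, the
other at the symbol before it or at the start of the string. -/
theorem evalString_eq_evalConst (v : List Bool → Bool) (s : List Symbol)
    (hs : firstVar s = none) : evalString v s = evalConst s := by
  induction s with
  | nil => rfl
  | cons a s ih =>
    cases a with
    | x => simp [firstVar] at hs
    | digit d =>
      cases h : evalConst s <;> simp [evalString, evalConst, leadDigits, applySymbol, h]
    | _ =>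
      simp only [firstVar, reduceCtorEq, if_false] at hs
      rw [evalConst, ← ih hs]
      simp only [evalString, evalRest, leadDigits]
      split_ifs <;> simp

theorem mem_SAT_iff_evalConst (s : List Symbol) (hs : firstVar s = none) :
    s ∈ SAT ↔ evalConst s = some [true] := by
  simp [mem_SAT_iff_evalString, evalString_eq_evalConst _ s hs]

end Complexity

namespace Complexity

open BoolFormula Turing StateTransition Function

/-! ### The combined machine -/

/-- The truth value of a digit. -/
def BoolFormula.Symbol.digit? : Symbol → Option Bool
  | .digit d => some d
  | _ => none

/-- The truth value of a constant. -/
def BoolFormula.Symbol.const? : Symbol → Option Bool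
  | .const c => some c
  | _ => none

namespace SelfReduction

/-- The stacks that are used beside those of the selector machine: two copies of the reversed
formula, the reversed name of the current variable, the part of that name that has already been
compared, and a stack of truth values. -/
inductive OwnStack : Type
  | text : Bool → OwnStack
  | name : OwnStack
  | shelf : OwnStack
  | out : OwnStack
  deriving DecidableEq, Fintype

/-- The alphabets of the stacks. -/
def OwnStack.alphabet : OwnStack → Type
  | text _ => Symbol
  | _ => Bool

/-- The labels that are used beside those of the selector machine. -/
inductive OwnLabel : Type
  | find : Option Bool → OwnLabel
  | subst : Bool → Bool → OwnLabel
  | restore : Bool → Bool → Option Symbol → OwnLabel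
  | clear : OwnLabel
  | eval : Bool → OwnLabel
  | finish : OwnLabel
  | reject : OwnLabel
  deriving Fintype

/-- Registers for symbols taken from stacks. -/
structure Registers : Type where
  /-- a symbol of a formula -/
  sym : Option Symbol
  /-- a bit -/
  fst : Option Bool
  /-- a further bit -/
  snd : Option Bool
  deriving Fintype

/-- The empty registers. -/
def Registers.empty : Registers := ⟨none, none, none⟩

variable (tm : FinTM2)

/-- The alphabets of all stacks. -/
abbrev Alphabet : OwnStack ⊕ tm.K → Type := Sum.elim OwnStack.alphabet tm.Γ

/-- Statements of the combined machine. -/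
abbrev Statement : Type := TM2.Stmt (Alphabet tm) (OwnLabel ⊕ tm.Λ) (Registers × tm.σ)

/-- Configurations of the combined machine. -/
abbrev Config : Type := TM2.Cfg (Alphabet tm) (OwnLabel ⊕ tm.Λ) (Registers × tm.σ)

variable {tm}

/-- A statement of the selector machine as a statement of the combined machine. Halting becomes a
jump. -/
def lift : TM2.Stmt tm.Γ tm.Λ tm.σ → Statement tm
  | .push k f q => .push (.inr k) (fun v => f v.2) (lift q)
  | .peek k f q => .peek (.inr k) (fun v a => (v.1, f v.2 a)) (lift q)
  | .pop k f q => .pop (.inr k) (fun v a => (v.1, f v.2 a)) (lift q)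
  | .load f q => .load (fun v => (v.1, f v.2)) (lift q)
  | .branch f q₁ q₂ => .branch (fun v => f v.2) (lift q₁) (lift q₂)
  | .goto f => .goto fun v => .inr (f v.2)
  | .halt => .goto fun _ => .inl (.find none)

/-- Pop a symbol of a formula. -/
def popText (b : Bool) (q : Statement tm) : Statement tm :=
  .pop (.inl (.text b)) (fun v a => ({ v.1 with sym := a }, v.2)) q

/-- Pop a digit of the name. -/
def popName (f : Registers × tm.σ → Option Bool → Registers × tm.σ) (q : Statement tm) :
    Statement tm :=
  .pop (.inl .name) f q

/-- Look at a digit of the name. -/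
def peekName (f : Registers × tm.σ → Option Bool → Registers × tm.σ) (q : Statement tm) :
    Statement tm :=
  .peek (.inl .name) f q

/-- Pop a digit from the shelf. -/
def popShelf (f : Registers × tm.σ → Option Bool → Registers × tm.σ) (q : Statement tm) :
    Statement tm :=
  .pop (.inl .shelf) f q

/-- Pop a truth value. -/
def popOut (f : Registers × tm.σ → Option Bool → Registers × tm.σ) (q : Statement tm) :
    Statement tm :=
  .pop (.inl .out) f q

/-- Jump. -/
def jump (l : OwnLabel) : Statement tm := .goto fun _ => .inl l

/-- Halt with the given answer. -/
def answer (tm : FinTM2) (b : Bool) : Statement tm :=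
  .push (.inl .out) (fun _ => b) <| .load (fun v => (Registers.empty, v.2)) .halt

/-- Whether the search for the first variable has not yet reached it (`none`), is inside it, or has
passed it. -/
def findNext : Option Bool → Option Symbol → Option Bool
  | none, a => if a = some .x then some true else none
  | some _, _ => some false

variable (ei : tm.Γ tm.k₀ ≃ Symbol ⊕ Symbol) (eo : tm.Γ tm.k₁ ≃ Symbol)

/-- A symbol of the first or the second component, as a symbol of the selector machine. -/
def inputSymbol (b : Bool) (a : Symbol) : tm.Γ tm.k₀ :=
  ei.symm (if b then .inr a else .inl a)

/-- Copy the formula from the output stack of the selector machine, and find the name of its first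
variable. -/
def findStmt (m : Option Bool) : Statement tm :=
  .pop (.inr tm.k₁) (fun v a => ({ v.1 with sym := a.map eo }, v.2)) <|
  .branch (fun v => v.1.sym.isNone)
    (jump (if m = none then .eval true else .subst true true))
    (.push (.inl (.text true)) (fun v => v.1.sym.getD .x) <|
    .push (.inl (.text false)) (fun v => v.1.sym.getD .x) <|
    .branch (fun v => m = some true ∧ (v.1.sym.bind Symbol.digit?).isSome)
      (.push (.inl .name) (fun v => (v.1.sym.bind Symbol.digit?).getD true) <| jump (.find m))
      (.goto fun v => .inl (.find (findNext m v.1.sym))))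

/-- Read a symbol of the formula from the right, comparing digits with the name. -/
def substStmt (b ok : Bool) : Statement tm :=
  popText b <|
  .branch (fun v => (v.1.sym.bind Symbol.digit?).isSome)
    (.push (.inr tm.k₀) (fun v => inputSymbol ei b (v.1.sym.getD .x)) <|
    popName (fun v a => ({ v.1 with fst := a }, v.2)) <|
    .branch (fun v => v.1.fst.isSome)
      (.push (.inl .shelf) (fun v => v.1.fst.getD true) <|
      .goto fun v => .inl (.subst b (ok && v.1.fst == v.1.sym.bind Symbol.digit?)))
      (jump (.subst b false)))
    (peekName (fun v a => ({ v.1 with fst := a }, v.2)) <|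
    .goto fun v => .inl (.restore b (v.1.sym = some .x ∧ ok ∧ v.1.fst = none) v.1.sym))

/-- Restore the name after the comparison, and write the symbol or the constant. -/
def restoreStmt (b hit : Bool) (a : Option Symbol) : Statement tm :=
  popShelf (fun v a => ({ v.1 with fst := a }, v.2)) <|
  .branch (fun v => v.1.fst.isSome)
    (.push (.inl .name) (fun v => v.1.fst.getD true) <|
    if hit then .pop (.inr tm.k₀) (fun v _ => v) (jump (.restore b hit a))
    else jump (.restore b hit a))
    (match a with
    | none => jump (if b then .subst false true else .clear)
    | some a =>
      .push (.inr tm.k₀) (fun _ => inputSymbol ei b (if hit then .const b else a)) <|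
      jump (.subst b true))

/-- Clear the name and start the selector machine. -/
def clearStmt : Statement tm :=
  popName (fun v a => ({ v.1 with fst := a }, v.2)) <|
  .branch (fun v => v.1.fst.isSome) (jump .clear) (.goto fun _ => .inr tm.main)

/-- The value of a conjunction or disjunction. -/
def binaryValue (a : Option Symbol) (b c : Bool) : Bool :=
  if a = some .and then b && c else b || c

/-- Evaluate a formula without variables from the right. -/
def evalStmt (ok : Bool) : Statement tm :=
  popText true <| popText false <|
  .branch (fun v => v.1.sym.isNone) (jump (if ok then .finish else .reject)) <|
  if ok then
    .branch (fun v => (v.1.sym.bind Symbol.const?).isSome)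
      (.push (.inl .out) (fun v => (v.1.sym.bind Symbol.const?).getD true) <| jump (.eval true)) <|
    .branch (fun v => v.1.sym = some .x ∨ (v.1.sym.bind Symbol.digit?).isSome)
      (jump (.eval false)) <|
    popOut (fun v a => ({ v.1 with fst := a }, v.2)) <|
    .branch (fun v => v.1.fst.isNone) (jump (.eval false)) <|
    .branch (fun v => v.1.sym = some .not)
      (.push (.inl .out) (fun v => !(v.1.fst.getD true)) <| jump (.eval true)) <|
    popOut (fun v a => ({ v.1 with snd := a }, v.2)) <|
    .branch (fun v => v.1.snd.isNone) (jump (.eval false)) <|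
    .push (.inl .out)
      (fun v => binaryValue v.1.sym (v.1.fst.getD true) (v.1.snd.getD true)) <|
    jump (.eval true)
  else jump (.eval false)

/-- Accept if the only truth value is `true`. -/
def finishStmt : Statement tm :=
  popOut (fun v a => ({ v.1 with fst := a }, v.2)) <|
  popOut (fun v a => ({ v.1 with snd := a }, v.2)) <|
  .branch (fun v => v.1.fst = some true ∧ v.1.snd = none) (answer tm true) (jump .reject)

/-- Clear the truth values and reject. -/
def rejectStmt : Statement tm :=
  popOut (fun v a => ({ v.1 with fst := a }, v.2)) <|
  .branch (fun v => v.1.fst.isSome) (jump .reject) (answer tm false)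

/-- The program of the combined machine. -/
def program : OwnLabel ⊕ tm.Λ → Statement tm
  | .inl (.find m) => findStmt eo m
  | .inl (.subst b ok) => substStmt ei b ok
  | .inl (.restore b hit a) => restoreStmt ei b hit a
  | .inl .clear => clearStmt
  | .inl (.eval ok) => evalStmt ok
  | .inl .finish => finishStmt
  | .inl .reject => rejectStmt
  | .inr l => lift (tm.m l)

/-- The contents of the stacks. -/
def contents (R : Bool → List Symbol) (w p o : List Bool) (T : ∀ k, List (tm.Γ k)) :
    ∀ k, List (Alphabet tm k)
  | .inl (.text b) => R b
  | .inl .name => w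
  | .inl .shelf => p
  | .inl .out => o
  | .inr k => T k

/-! ### Effect of statements on the stacks, and simulation of the selector -/

section contents

variable (R : Bool → List Symbol) (w p o : List Bool) (T : ∀ k, List (tm.Γ k))

theorem update_contents_text (b : Bool) (l : List Symbol) :
    update (contents R w p o T) (.inl (.text b)) l = contents (update R b l) w p o T := by
  ext1 k
  rcases k with (c | _ | _ | _) | k
  · by_cases h : c = b
    · subst h
      exact (update_self (f := contents R w p o T) _ _).trans (update_self (f := R) c l).symm
    · have h' : update R b l c = R c := update_of_ne h l R
      exact (update_of_ne (by simpa using h) _ _).trans h'.symm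
  all_goals exact update_of_ne (by simp) _ _

theorem update_contents_name (l : List Bool) :
    update (contents R w p o T) (.inl .name) l = contents R l p o T := by
  ext1 k
  rcases k with (c | _ | _ | _) | k
  case inl.name => exact update_self (f := contents R w p o T) _ _
  all_goals exact update_of_ne (by simp) _ _

theorem update_contents_shelf (l : List Bool) :
    update (contents R w p o T) (.inl .shelf) l = contents R w l o T := by
  ext1 k
  rcases k with (c | _ | _ | _) | k
  case inl.shelf => exact update_self (f := contents R w p o T) _ _
  all_goals exact update_of_ne (by simp) _ _

theorem update_contents_out (l : List Bool) :
    update (contents R w p o T) (.inl .out) l = contents R w p l T := by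
  ext1 k
  rcases k with (c | _ | _ | _) | k
  case inl.out => exact update_self (f := contents R w p o T) _ _
  all_goals exact update_of_ne (by simp) _ _

theorem update_contents_inr (k : tm.K) (l : List (tm.Γ k)) :
    update (contents R w p o T) (.inr k) l = contents R w p o (update T k l) := by
  ext1 j
  rcases j with (c | _ | _ | _) | j
  case inr =>
    by_cases h : j = k
    · subst h
      exact (update_self (f := contents R w p o T) _ _).trans (update_self (f := T) j l).symm
    · have h' : update T k l j = T j := update_of_ne h l T
      exact (update_of_ne (by simpa using h) _ _).trans h'.symm
  all_goals exact update_of_ne (by simp) _ _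

variable (v : Registers × tm.σ) (q : Statement tm)

@[simp]
theorem stepAux_popText (b : Bool) :
    TM2.stepAux (popText b q) v (contents R w p o T) =
      TM2.stepAux q ({ v.1 with sym := (R b).head? }, v.2)
        (contents (update R b (R b).tail) w p o T) :=
  congrArg (TM2.stepAux q _) (update_contents_text R w p o T b _)

@[simp]
theorem stepAux_push_text (b : Bool) (f : Registers × tm.σ → Symbol) :
    TM2.stepAux (.push (.inl (.text b)) f q) v (contents R w p o T) =
      TM2.stepAux q v (contents (update R b (f v :: R b)) w p o T) :=
  congrArg (TM2.stepAux q _) (update_contents_text R w p o T b _)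

@[simp]
theorem stepAux_push_name (f : Registers × tm.σ → Bool) :
    TM2.stepAux (.push (.inl .name) f q) v (contents R w p o T) =
      TM2.stepAux q v (contents R (f v :: w) p o T) :=
  congrArg (TM2.stepAux q _) (update_contents_name R w p o T _)

@[simp]
theorem stepAux_popName (f : Registers × tm.σ → Option Bool → Registers × tm.σ) :
    TM2.stepAux (popName f q) v (contents R w p o T) =
      TM2.stepAux q (f v w.head?) (contents R w.tail p o T) :=
  congrArg (TM2.stepAux q _) (update_contents_name R w p o T _)

@[simp]
theorem stepAux_peekName (f : Registers × tm.σ → Option Bool → Registers × tm.σ) :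
    TM2.stepAux (peekName f q) v (contents R w p o T) =
      TM2.stepAux q (f v w.head?) (contents R w p o T) :=
  rfl

@[simp]
theorem stepAux_push_shelf (f : Registers × tm.σ → Bool) :
    TM2.stepAux (.push (.inl .shelf) f q) v (contents R w p o T) =
      TM2.stepAux q v (contents R w (f v :: p) o T) :=
  congrArg (TM2.stepAux q _) (update_contents_shelf R w p o T _)

@[simp]
theorem stepAux_popShelf (f : Registers × tm.σ → Option Bool → Registers × tm.σ) :
    TM2.stepAux (popShelf f q) v (contents R w p o T) =
      TM2.stepAux q (f v p.head?) (contents R w p.tail o T) :=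
  congrArg (TM2.stepAux q _) (update_contents_shelf R w p o T _)

@[simp]
theorem stepAux_push_out (f : Registers × tm.σ → Bool) :
    TM2.stepAux (.push (.inl .out) f q) v (contents R w p o T) =
      TM2.stepAux q v (contents R w p (f v :: o) T) :=
  congrArg (TM2.stepAux q _) (update_contents_out R w p o T _)

@[simp]
theorem stepAux_popOut (f : Registers × tm.σ → Option Bool → Registers × tm.σ) :
    TM2.stepAux (popOut f q) v (contents R w p o T) =
      TM2.stepAux q (f v o.head?) (contents R w p o.tail T) :=
  congrArg (TM2.stepAux q _) (update_contents_out R w p o T _)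

@[simp]
theorem stepAux_push_inr (k : tm.K) (f : Registers × tm.σ → tm.Γ k) :
    TM2.stepAux (.push (.inr k) f q) v (contents R w p o T) =
      TM2.stepAux q v (contents R w p o (update T k (f v :: T k))) :=
  congrArg (TM2.stepAux q _) (update_contents_inr R w p o T k _)

@[simp]
theorem stepAux_pop_inr (k : tm.K)
    (f : Registers × tm.σ → Option (tm.Γ k) → Registers × tm.σ) :
    TM2.stepAux (.pop (.inr k) f q) v (contents R w p o T) =
      TM2.stepAux q (f v (T k).head?) (contents R w p o (update T k (T k).tail)) :=
  congrArg (TM2.stepAux q _) (update_contents_inr R w p o T k _)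

@[simp]
theorem stepAux_jump (l : OwnLabel) (S : ∀ k, List (Alphabet tm k)) :
    TM2.stepAux (jump l) v S = ⟨some (.inl l), v, S⟩ :=
  rfl

@[simp]
theorem stepAux_answer (b : Bool) :
    TM2.stepAux (answer tm b) v (contents R w p o T) =
      ⟨none, (Registers.empty, v.2), contents R w p (b :: o) T⟩ :=
  stepAux_push_out ..

/-- A configuration of the selector machine as a configuration of the combined machine. -/
def embed (v : Registers) (c : tm.Cfg) : Config tm :=
  ⟨some (c.l.elim (.inl (.find none)) .inr), (v, c.var), contents R w p o c.stk⟩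

theorem stepAux_lift (v : Registers) (q : TM2.Stmt tm.Γ tm.Λ tm.σ) (x : tm.σ) :
    TM2.stepAux (lift q) (v, x) (contents R w p o T) = embed R w p o v (TM2.stepAux q x T) := by
  induction q generalizing x T with
  | push k f q ih => exact (stepAux_push_inr ..).trans (ih _ _)
  | peek k f q ih => exact ih _ _
  | pop k f q ih => exact (stepAux_pop_inr ..).trans (ih _ _)
  | load f q ih => exact ih _ _
  | branch f q₁ q₂ ih₁ ih₂ => cases h : f x <;> simp only [lift, TM2.stepAux, h, ih₁, ih₂, cond]
  | goto f => rfl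
  | halt => rfl

/-- The two machines differ only after the selector halts. A halted configuration with steps left
would iterate to `none`, contrary to `h`, so halting can occur only at the last step. -/
theorem iterate_embed (v : Registers) (n : ℕ) (c c' : tm.Cfg)
    (h : (flip bind tm.step)^[n] (some c) = some c') :
    (flip bind (TM2.step (program ei eo)))^[n] (some (embed R w p o v c)) =
      some (embed R w p o v c') := by
  induction n generalizing c with
  | zero => exact congrArg (Option.map (embed R w p o v)) h
  | succ n ih =>
    have hnone : ∀ k, (flip bind tm.step)^[k] none = none := fun k => by
      induction k with
      | zero => rfl
      | succ k ihk => rwa [iterate_succ_apply]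
    obtain ⟨_ | l, x, T⟩ := c
    · have : (flip bind tm.step)^[n] none = some c' := h
      cases (hnone n).symm.trans this
    · rw [iterate_succ_apply] at h ⊢
      refine Eq.trans (congrArg _ ?_) (ih _ h)
      exact congrArg some (stepAux_lift R w p o T v (tm.m l) x)

end contents

end SelfReduction

end Complexity

namespace Complexity

open BoolFormula Turing StateTransition Function

namespace SelfReduction

variable {tm : FinTM2} (ei : tm.Γ tm.k₀ ≃ Symbol ⊕ Symbol) (eo : tm.Γ tm.k₁ ≃ Symbol)

/-! ### Timed runs -/

/-- The stacks of a machine, all empty but one. -/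
def single (k : tm.K) (l : List (tm.Γ k)) : ∀ k, List (tm.Γ k) := update (fun _ => []) k l

@[simp]
theorem single_self (k : tm.K) (l : List (tm.Γ k)) : single k l k = l := update_self ..

@[simp]
theorem update_single (k : tm.K) (l l' : List (tm.Γ k)) :
    update (single k l) k l' = single k l' := update_idem ..

theorem single_nil (k k' : tm.K) : single k [] = single k' [] :=
  (update_eq_self ..).trans (update_eq_self ..).symm

/-- The combined machine goes from one label and stack contents to another in at most `n` steps. The
registers do not matter. -/
def Goes (n : ℕ) (l : OwnLabel ⊕ tm.Λ) (S : ∀ k, List (Alphabet tm k)) (l' : OwnLabel ⊕ tm.Λ)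
    (S' : ∀ k, List (Alphabet tm k)) : Prop :=
  ∀ v, ∃ v', Nonempty (EvalsToInTime (TM2.step (program ei eo)) ⟨some l, (v, tm.initialState), S⟩
    (some ⟨some l', (v', tm.initialState), S'⟩) n)

/-- The combined machine halts in at most `n` steps, with the answer `b`. -/
def Answers (n : ℕ) (l : OwnLabel ⊕ tm.Λ) (S : ∀ k, List (Alphabet tm k)) (b : Bool) : Prop :=
  ∀ v, Nonempty (EvalsToInTime (TM2.step (program ei eo)) ⟨some l, (v, tm.initialState), S⟩
    (some ⟨none, (Registers.empty, tm.initialState),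
      contents (fun _ => []) [] [] [b] (fun _ => [])⟩) n)

variable {ei eo} {m n : ℕ} {l l' l'' : OwnLabel ⊕ tm.Λ} {S S' S'' : ∀ k, List (Alphabet tm k)}
  {b : Bool}

theorem Goes.trans (h : Goes ei eo m l S l' S') (h' : Goes ei eo n l' S' l'' S'') :
    Goes ei eo (n + m) l S l'' S'' := fun v => by
  obtain ⟨v', ⟨e⟩⟩ := h v
  obtain ⟨v'', ⟨e'⟩⟩ := h' v'
  exact ⟨v'', ⟨EvalsToInTime.trans _ _ _ _ _ _ e e'⟩⟩

theorem Goes.answers (h : Goes ei eo m l S l' S') (h' : Answers ei eo n l' S' b) :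
    Answers ei eo (n + m) l S b := fun v => by
  obtain ⟨v', ⟨e⟩⟩ := h v
  obtain ⟨e'⟩ := h' v'
  exact ⟨EvalsToInTime.trans _ _ _ _ _ _ e e'⟩

theorem Goes.mono (h : Goes ei eo m l S l' S') (hmn : m ≤ n) : Goes ei eo n l S l' S' := fun v => by
  obtain ⟨v', ⟨e⟩⟩ := h v
  exact ⟨v', ⟨⟨e.toEvalsTo, e.steps_le_m.trans hmn⟩⟩⟩

theorem Answers.mono (h : Answers ei eo m l S b) (hmn : m ≤ n) : Answers ei eo n l S b := fun v => by
  obtain ⟨e⟩ := h v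
  exact ⟨⟨e.toEvalsTo, e.steps_le_m.trans hmn⟩⟩

theorem Goes.refl : Goes ei eo 0 l S l S := fun v => ⟨v, ⟨EvalsToInTime.refl _ _⟩⟩

theorem Goes.single_step (h : ∀ v, ∃ v', TM2.stepAux (program ei eo l) (v, tm.initialState) S =
    ⟨some l', (v', tm.initialState), S'⟩) : Goes ei eo 1 l S l' S' := fun v => by
  obtain ⟨v', h⟩ := h v
  exact ⟨v', ⟨⟨⟨1, congrArg some h⟩, le_rfl⟩⟩⟩

theorem Answers.single_step (h : ∀ v, TM2.stepAux (program ei eo l) (v, tm.initialState) S =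
    ⟨none, (Registers.empty, tm.initialState), contents (fun _ => []) [] [] [b] (fun _ => [])⟩) :
    Answers ei eo 1 l S b := fun v =>
  ⟨⟨⟨1, congrArg some (h v)⟩, le_rfl⟩⟩

variable (R : Bool → List Symbol) (w p o : List Bool)

@[simp]
theorem update_true_update_false {α : Type} (r s t : α) :
    update (update (fun _ : Bool => r) true s) false t = fun c => if c then s else t := by
  ext1 c
  cases c <;> simp

/-! ### Finding the first variable -/

theorem goes_find_after (s r : List Symbol) :
    Goes ei eo (s.length + 1) (.inl (.find (some false)))
      (contents (fun _ => r) w p o (single tm.k₁ (s.map eo.symm)))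
      (.inl (.subst true true)) (contents (fun _ => s.reverse ++ r) w p o (single tm.k₁ [])) := by
  induction s generalizing r with
  | nil =>
    refine .single_step fun v => ⟨{ v with sym := none }, ?_⟩
    simp [program, findStmt]
  | cons a s ih =>
    rw [List.reverse_cons, List.append_assoc]
    refine (Goes.single_step fun v => ⟨{ v with sym := some a }, ?_⟩).trans (ih (a :: r))
    simp [program, findStmt, findNext]

theorem leadDigits_cons_of_digit?_eq_none {a : Symbol} {s : List Symbol} (ha : a.digit? = none) :
    leadDigits (a :: s) = [] := by
  cases a <;> simp_all [Symbol.digit?, leadDigits]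

/-- Pushing reverses, so the name ends up with its last digit on top, the order in which a
right-to-left scan of the text meets digits. The extra step detects the empty stack. -/
theorem goes_find_inside (s r : List Symbol) :
    Goes ei eo (s.length + 1) (.inl (.find (some true)))
      (contents (fun _ => r) w p o (single tm.k₁ (s.map eo.symm)))
      (.inl (.subst true true))
      (contents (fun _ => s.reverse ++ r) ((leadDigits s).reverse ++ w) p o
        (single tm.k₁ [])) := by
  induction s generalizing r w with
  | nil =>
    refine .single_step fun v => ⟨{ v with sym := none }, ?_⟩
    simp [program, findStmt, leadDigits]
  | cons a s ih =>
    rw [List.reverse_cons, List.append_assoc]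
    cases ha : a.digit? with
    | some d =>
      obtain rfl : a = .digit d := by cases a <;> simp_all [Symbol.digit?]
      rw [leadDigits, List.reverse_cons, List.append_assoc]
      refine (Goes.single_step fun v => ⟨{ v with sym := some (.digit d) }, ?_⟩).trans
        (ih (d :: w) (.digit d :: r))
      simp [program, findStmt, Symbol.digit?]
    | none =>
      rw [leadDigits_cons_of_digit?_eq_none ha]
      refine (Goes.single_step fun v => ⟨{ v with sym := some a }, ?_⟩).trans
        (goes_find_after w p o s (a :: r))
      simp [program, findStmt, findNext, ha]

theorem goes_find_some (s r : List Symbol) (u : List Bool) (hu : firstVar s = some u) :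
    Goes ei eo (s.length + 1) (.inl (.find none))
      (contents (fun _ => r) w p o (single tm.k₁ (s.map eo.symm)))
      (.inl (.subst true true))
      (contents (fun _ => s.reverse ++ r) (u.reverse ++ w) p o (single tm.k₁ [])) := by
  induction s generalizing r with
  | nil => simp [firstVar] at hu
  | cons a s ih =>
    rw [List.reverse_cons, List.append_assoc]
    rw [firstVar] at hu
    split_ifs at hu with ha
    · subst ha
      obtain rfl := Option.some.inj hu
      refine (Goes.single_step fun v => ⟨{ v with sym := some .x }, ?_⟩).trans
        (goes_find_inside w p o s (.x :: r))
      simp [program, findStmt, findNext]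
    · refine (Goes.single_step fun v => ⟨{ v with sym := some a }, ?_⟩).trans (ih (a :: r) hu)
      simp [program, findStmt, findNext, ha]

theorem goes_find_none (s r : List Symbol) (hs : firstVar s = none) :
    Goes ei eo (s.length + 1) (.inl (.find none))
      (contents (fun _ => r) w p o (single tm.k₁ (s.map eo.symm)))
      (.inl (.eval true)) (contents (fun _ => s.reverse ++ r) w p o (single tm.k₁ [])) := by
  induction s generalizing r with
  | nil =>
    refine .single_step fun v => ⟨{ v with sym := none }, ?_⟩
    simp [program, findStmt]
  | cons a s ih =>
    rw [List.reverse_cons, List.append_assoc]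
    rw [firstVar] at hs
    split_ifs at hs with ha
    refine (Goes.single_step fun v => ⟨{ v with sym := some a }, ?_⟩).trans (ih (a :: r) hs)
    simp [program, findStmt, findNext, ha]

/-! ### Substituting for the variable -/

theorem goes_restore (b hit : Bool) (a : Option Symbol) (x : List (tm.Γ tm.k₀)) :
    Goes ei eo p.length (.inl (.restore b hit a)) (contents R w p o (single tm.k₀ x))
      (.inl (.restore b hit a))
      (contents R (p.reverse ++ w) [] o
        (single tm.k₀ (if hit then x.drop p.length else x))) := by
  induction p generalizing w x with
  | nil => simpa using Goes.refl
  | cons d p ih =>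
    rw [List.reverse_cons, List.append_assoc]
    have h := ih (d :: w) (if hit then x.tail else x)
    have hx : (if hit then (if hit then x.tail else x).drop p.length
        else if hit then x.tail else x) = if hit then x.drop (d :: p).length else x := by
      cases hit <;> simp
    rw [hx] at h
    refine (Goes.single_step fun v => ⟨{ v with fst := some d }, ?_⟩).trans h
    cases hit <;> simp [program, restoreStmt]

theorem substString_cons (w : List Bool) (b : Bool) (a : Symbol) (s : List Symbol)
    (ha : a.digit? = none) :
    substString w b (a :: s) = if a = .x ∧ leadDigits s = w then .const b :: substRest w b s
      else a :: substString w b s := by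
  cases a <;> simp_all [substString, leadDigits, substRest, Symbol.digit?]

/-- The digits `u` have been compared with the end of the name `w`, where `q` is what is left on the
name stack, `p` is what is on the shelf, and `ok` tells whether all digits agreed. -/
def Compared (w u q p : List Bool) (ok : Bool) : Prop :=
  w.reverse = p.reverse ++ q ∧ (ok = true → p = u) ∧
    (ok = false → ∀ q', w.reverse ≠ u.reverse ++ q')

theorem Compared.eq_iff {w u q p : List Bool} {ok : Bool} (h : Compared w u q p ok) :
    u = w ↔ ok = true ∧ q = [] := by
  obtain ⟨h1, h2, h3⟩ := h
  constructor
  · rintro rfl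
    cases ok
    · exact absurd (List.append_nil _).symm (h3 rfl [])
    · obtain rfl := h2 rfl
      exact ⟨rfl, by simpa using h1⟩
  · rintro ⟨rfl, rfl⟩
    obtain rfl := h2 rfl
    simpa using h1.symm

theorem Compared.length_le {w u q p : List Bool} {ok : Bool} (h : Compared w u q p ok) :
    p.length ≤ w.length := by
  have := congrArg List.length h.1
  simp at this
  omega

theorem Compared.cons {w u q p : List Bool} {ok : Bool} {e : Bool}
    (h : Compared w u (e :: q) p ok) (d : Bool) :
    Compared w (d :: u) q (e :: p) (ok && e == d) := by
  obtain ⟨h1, h2, h3⟩ := h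
  refine ⟨by simp [h1], fun hok => ?_, fun hok q' hq' => ?_⟩
  · simp_all
  · rw [List.reverse_cons, List.append_assoc] at hq'
    cases ok
    · exact h3 rfl _ hq'
    · obtain rfl := h2 rfl
      rw [h1] at hq'
      simp_all

/-- With the name used up, a further digit makes the block longer than the name, so the mismatch is
final. -/
theorem Compared.nil {w u p : List Bool} {ok : Bool} (h : Compared w u [] p ok) (d : Bool) :
    Compared w (d :: u) [] p false := by
  obtain ⟨h1, h2, h3⟩ := h
  refine ⟨h1, by simp, fun _ q' hq' => ?_⟩
  cases ok
  · exact h3 rfl ([d] ++ q') (by simpa using hq')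
  · obtain rfl := h2 rfl
    rw [h1] at hq'
    simp at hq'

/-- Here `s` is unread and `t` already processed. Digits are copied provisionally before it is known
which variable they belong to, which is why `substString` keeps leading digits. Each symbol, and the
end of the text, costs at most one reading step, `w.length` steps to restore the name and one
writing step. -/
theorem goes_subst (b : Bool) (s t : List Symbol) (q : List Bool) (ok : Bool)
    (x : List (tm.Γ tm.k₀)) (h : Compared w (leadDigits t) q p ok) :
    Goes ei eo ((s.length + 1) * (w.length + 2)) (.inl (.subst b ok))
      (contents (update R b s.reverse) q p o
        (single tm.k₀ ((substString w b t).map (inputSymbol ei b) ++ x)))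
      (.inl (if b then .subst false true else .clear))
      (contents (update R b []) w.reverse [] o
        (single tm.k₀ ((substString w b (s ++ t)).map (inputSymbol ei b) ++ x))) := by
  induction s using List.reverseRecOn generalizing t q p ok with
  | nil =>
    have hp := h.length_le
    refine ((Goes.single_step fun v => ⟨{ v with sym := none, fst := q.head? }, ?_⟩).trans
      ((goes_restore (update R b []) q p o b false none
        ((substString w b t).map (inputSymbol ei b) ++ x)).trans
        (Goes.single_step fun v => ⟨{ v with fst := none }, ?_⟩))).mono ?_
    · simp [program, substStmt]
    · simp [program, restoreStmt, h.1]
    · simp; omega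
  | append_singleton s a ih =>
    have hp := h.length_le
    rw [List.append_assoc, List.reverse_append]
    cases ha : a.digit? with
    | some d =>
      obtain rfl : a = .digit d := by cases a <;> simp_all [Symbol.digit?]
      rcases q with _ | ⟨e, q⟩
      · refine ((Goes.single_step fun v => ⟨{ v with sym := some (.digit d), fst := none }, ?_⟩).trans
          (ih p (.digit d :: t) [] false (h.nil d))).mono ?_
        · simp [program, substStmt, Symbol.digit?, substString, leadDigits, substRest]
        · simp [add_mul]
      · refine ((Goes.single_step fun v => ⟨{ v with sym := some (.digit d), fst := some e }, ?_⟩).trans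
          (ih (e :: p) (.digit d :: t) q (ok && e == d) (h.cons d))).mono ?_
        · simp [program, substStmt, Symbol.digit?, substString, leadDigits, substRest]
        · simp [add_mul]
    | none =>
      have hnew : Compared w (leadDigits (a :: t)) w.reverse [] true := by
        simp [Compared, leadDigits_cons_of_digit?_eq_none ha]
      -- On a hit the shelf holds exactly the digits of the name, so one pop per shelved digit
      -- removes exactly their provisional copies.
      have hpt : leadDigits t = w → p.length = (leadDigits t).length := fun hw => by
        rw [h.2.1 (h.eq_iff.1 hw).1]
      refine (((Goes.single_step fun v => ⟨{ v with sym := some a, fst := q.head? }, ?_⟩).trans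
        ((goes_restore (update R b s.reverse) q p o b (a = .x ∧ leadDigits t = w) (some a)
          ((substString w b t).map (inputSymbol ei b) ++ x)).trans
          (Goes.single_step fun v => ⟨{ v with fst := none }, ?_⟩))).trans
            (ih [] (a :: t) w.reverse true hnew)).mono ?_
      · simp [program, substStmt, ha, h.eq_iff]
      · rw [substString_cons w b a t ha]
        by_cases hc : a = .x ∧ leadDigits t = w
        · simp [program, restoreStmt, hc, h.1, substString, hpt hc.2]
        · simp [program, restoreStmt, hc, h.1]
      · simp [add_mul]; omega

/-! ### Calling the selector -/

theorem goes_clear (T : ∀ k, List (tm.Γ k)) :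
    Goes ei eo (w.length + 1) (.inl .clear) (contents R w p o T) (.inr tm.main)
      (contents R [] p o T) := by
  induction w with
  | nil =>
    refine Goes.single_step fun v => ⟨{ v with fst := none }, ?_⟩
    simp [program, clearStmt]
  | cons d w ih =>
    refine (Goes.single_step fun v => ⟨{ v with fst := some d }, ?_⟩).trans ih
    simp [program, clearStmt]

theorem initList_eq (x : List (tm.Γ tm.k₀)) :
    initList tm x = ⟨some tm.main, tm.initialState, single tm.k₀ x⟩ := by
  simp only [initList, single]
  congr 1
  ext1 k
  by_cases h : k = tm.k₀
  · subst h; simp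
  · simp [h]

theorem haltList_eq (x : List (tm.Γ tm.k₁)) :
    haltList tm x = ⟨none, tm.initialState, single tm.k₁ x⟩ := by
  simp only [haltList, single]
  congr 1
  ext1 k
  by_cases h : k = tm.k₁
  · subst h; simp
  · simp [h]

/-- A halting selector is back in its initial state with all stacks but the output empty, so it can
be called again without any cleaning up. -/
theorem goes_call (x : List (tm.Γ tm.k₀)) (y : List (tm.Γ tm.k₁))
    (h : TM2OutputsInTime tm x (some y) n) :
    Goes ei eo n (.inr tm.main) (contents R w p o (single tm.k₀ x))
      (.inl (.find none)) (contents R w p o (single tm.k₁ y)) := fun v => by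
  obtain ⟨⟨k, hk⟩, hkn⟩ := h
  have := iterate_embed ei eo R w p o v k _ _ hk
  rw [initList_eq, haltList_eq] at this
  exact ⟨v, ⟨⟨⟨k, this⟩, hkn⟩⟩⟩

/-! ### Evaluating without variables -/

theorem answers_reject :
    Answers ei eo (o.length + 1) (.inl .reject) (contents (fun _ => []) [] [] o (fun _ => []))
      false := by
  induction o with
  | nil => exact .single_step fun v => by simp [program, rejectStmt]
  | cons d o ih =>
    refine (Goes.single_step fun v => ⟨{ v with fst := some d }, ?_⟩).answers ih
    simp [program, rejectStmt]

theorem answers_finish :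
    Answers ei eo (o.length + 2) (.inl .finish) (contents (fun _ => []) [] [] o (fun _ => []))
      (o = [true]) := by
  by_cases ho : o = [true]
  · subst ho
    refine (Answers.single_step fun v => ?_).mono (Nat.le_add_left 1 _)
    simp [program, finishStmt]
  · refine ((Goes.single_step fun v => ⟨{ v with fst := o.head?, snd := o.tail.head? }, ?_⟩).answers
      (by simpa only [ho, decide_false] using answers_reject o.tail.tail)).mono ?_
    · rcases o with _ | ⟨_ | _, _ | _⟩ <;> simp_all [program, finishStmt]
    · simp; omega

/-- After an error the machine cannot halt at once: a proper halting configuration requires the text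
and the truth values to be cleared. -/
theorem answers_eval_false (s : List Symbol) :
    Answers ei eo (s.length + o.length + 2) (.inl (.eval false))
      (contents (fun _ => s) [] [] o (fun _ => [])) false := by
  induction s with
  | nil =>
    refine ((Goes.single_step fun v => ⟨{ v with sym := none }, ?_⟩).answers
      (answers_reject o)).mono ?_
    · simp [program, evalStmt]
    · simp
  | cons a s ih =>
    refine ((Goes.single_step fun v => ⟨{ v with sym := some a }, ?_⟩).answers ih).mono ?_
    · simp [program, evalStmt]
    · simp

theorem goes_eval_of_applySymbol (a : Symbol) (s : List Symbol) (o' : List Bool)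
    (h : applySymbol a o = some o') :
    Goes ei eo 1 (.inl (.eval true)) (contents (fun _ => a :: s) [] [] o (fun _ => []))
      (.inl (.eval true)) (contents (fun _ => s) [] [] o' (fun _ => [])) := by
  refine Goes.single_step fun v => ?_
  cases a
  case const c =>
    obtain rfl := Option.some.inj h
    exact ⟨{ v with sym := some (.const c) }, by simp [program, evalStmt, Symbol.const?]⟩
  case not =>
    rcases o with _ | ⟨d, o⟩ <;> simp [applySymbol] at h
    subst h
    exact ⟨{ v with sym := some .not, fst := some d },
      by simp [program, evalStmt, Symbol.const?, Symbol.digit?]⟩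
  case and =>
    rcases o with _ | ⟨d, _ | ⟨e, o⟩⟩ <;> simp [applySymbol] at h
    subst h
    exact ⟨⟨some .and, some d, some e⟩,
      by simp [program, evalStmt, binaryValue, Symbol.const?, Symbol.digit?]⟩
  case or =>
    rcases o with _ | ⟨d, _ | ⟨e, o⟩⟩ <;> simp [applySymbol] at h
    subst h
    exact ⟨⟨some .or, some d, some e⟩,
      by simp [program, evalStmt, binaryValue, Symbol.const?, Symbol.digit?]⟩
  all_goals simp [applySymbol] at h

theorem goes_eval_of_applySymbol_eq_none (a : Symbol) (s : List Symbol)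
    (h : applySymbol a o = none) :
    ∃ o', o'.length ≤ o.length ∧
      Goes ei eo 1 (.inl (.eval true)) (contents (fun _ => a :: s) [] [] o (fun _ => []))
        (.inl (.eval false)) (contents (fun _ => s) [] [] o' (fun _ => [])) := by
  cases a
  case const c => simp [applySymbol] at h
  case x =>
    refine ⟨o, le_rfl, Goes.single_step fun v => ⟨{ v with sym := some .x }, ?_⟩⟩
    simp [program, evalStmt, Symbol.const?]
  case digit d =>
    refine ⟨o, le_rfl, Goes.single_step fun v => ⟨{ v with sym := some (.digit d) }, ?_⟩⟩
    simp [program, evalStmt, Symbol.const?, Symbol.digit?]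
  case not =>
    rcases o with _ | ⟨d, o⟩ <;> simp [applySymbol] at h
    refine ⟨[], le_rfl, Goes.single_step fun v => ⟨⟨some .not, none, v.snd⟩, ?_⟩⟩
    simp [program, evalStmt, Symbol.const?, Symbol.digit?]
  case and =>
    rcases o with _ | ⟨d, _ | ⟨e, o⟩⟩ <;> simp [applySymbol] at h
    · refine ⟨[], le_rfl, Goes.single_step fun v => ⟨⟨some .and, none, v.snd⟩, ?_⟩⟩
      simp [program, evalStmt, Symbol.const?, Symbol.digit?]
    · refine ⟨[], Nat.zero_le _, Goes.single_step fun v => ⟨⟨some .and, some d, none⟩, ?_⟩⟩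
      simp [program, evalStmt, Symbol.const?, Symbol.digit?]
  case or =>
    rcases o with _ | ⟨d, _ | ⟨e, o⟩⟩ <;> simp [applySymbol] at h
    · refine ⟨[], le_rfl, Goes.single_step fun v => ⟨⟨some .or, none, v.snd⟩, ?_⟩⟩
      simp [program, evalStmt, Symbol.const?, Symbol.digit?]
    · refine ⟨[], Nat.zero_le _, Goes.single_step fun v => ⟨⟨some .or, some d, none⟩, ?_⟩⟩
      simp [program, evalStmt, Symbol.const?, Symbol.digit?]

theorem evalConst_append_eq_none (s t : List Symbol) (h : evalConst t = none) :
    evalConst (s ++ t) = none := by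
  induction s with
  | nil => exact h
  | cons a s ih => simp [evalConst, ih]

theorem length_le_of_applySymbol {a : Symbol} {o o' : List Bool}
    (h : applySymbol a o = some o') : o'.length ≤ o.length + 1 := by
  fun_cases applySymbol a o <;> simp_all [applySymbol] <;> subst h <;> simp

/-- Each symbol costs one step and leaves at most one more truth value to clear, hence the factor 2.
-/
theorem answers_eval_true (s t : List Symbol) (h : evalConst t = some o) :
    Answers ei eo (2 * s.length + o.length + 3) (.inl (.eval true))
      (contents (fun _ => s.reverse) [] [] o (fun _ => []))
      (evalConst (s ++ t) = some [true]) := by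
  induction s using List.reverseRecOn generalizing t o with
  | nil =>
    have ho : decide (evalConst ([] ++ t) = some [true]) = decide (o = [true]) := by simp [h]
    rw [ho]
    refine ((Goes.single_step fun v => ⟨{ v with sym := none }, ?_⟩).answers
      (answers_finish o)).mono ?_
    · simp [program, evalStmt]
    · simp
  | append_singleton s a ih =>
    rw [List.append_assoc, List.reverse_append]
    cases ha : applySymbol a o with
    | some o' =>
      have := length_le_of_applySymbol ha
      refine ((goes_eval_of_applySymbol o a s.reverse o' ha).answers
        (ih o' (a :: t) (by simp [evalConst, h, ha]))).mono ?_
      simp; omega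
    | none =>
      obtain ⟨o', ho', hgo⟩ := goes_eval_of_applySymbol_eq_none (ei := ei) (eo := eo) o a s.reverse ha
      have hnone : evalConst (s ++ ([a] ++ t)) = none :=
        evalConst_append_eq_none _ _ (by simp [evalConst, h, ha])
      simp only [hnone, reduceCtorEq, decide_false]
      refine (hgo.answers (answers_eval_false o' s.reverse)).mono ?_
      simp; omega

end SelfReduction

end Complexity

namespace Complexity

open BoolFormula Turing StateTransition Function

namespace SelfReduction

/-! ### Rounds, total time and the decider -/

theorem polynomial_eval_mono (p : Polynomial ℕ) : Monotone fun n => p.eval n := by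
  intro m n h
  simp only [Polynomial.eval_eq_sum, Polynomial.sum]
  gcongr

/-- A bound for the number of steps of one round, where `N` bounds the length of the formula and `p`
the time that the selector needs. -/
noncomputable def roundTime (p : Polynomial ℕ) : Polynomial ℕ :=
  p.comp (2 * .X) + 2 * ((.X + 1) * (.X + 2)) + 3 * .X + 4

/-- A bound for the number of steps of all rounds. -/
noncomputable def totalTime (p : Polynomial ℕ) : Polynomial ℕ := (.X + 1) * roundTime p

theorem roundTime_eval (p : Polynomial ℕ) (N : ℕ) : (roundTime p).eval N =
    p.eval (2 * N) + 2 * ((N + 1) * (N + 2)) + 3 * N + 4 := by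
  simp [roundTime]

variable {f : List Symbol × List Symbol → List Symbol}
  (h : TM2ComputableInPolyTime (stringPairEncoding Symbol).encode (stringEncoding Symbol).encode f)

theorem goes_round (s : List Symbol) (w : List Bool) (hw : firstVar s = some w) (N : ℕ)
    (hN : s.length ≤ N) :
    Goes h.inputAlphabet h.outputAlphabet ((roundTime h.time).eval N) (.inl (.find none))
      (contents (fun _ => []) [] [] [] (single h.tm.k₁ (s.map h.outputAlphabet.symm)))
      (.inl (.find none))
      (contents (fun _ => []) [] [] [] (single h.tm.k₁
        ((f (substString w false s, substString w true s)).map h.outputAlphabet.symm))) := by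
  have hwN := (length_firstVar_le w s hw).trans hN
  have hc : Compared w [] w.reverse [] true := by simp [Compared]
  have h₁ := goes_find_some (ei := h.inputAlphabet) (eo := h.outputAlphabet) [] [] [] s [] w hw
  -- The instance for `true` is written first: stacks fill from the bottom, and it is the second
  -- component of the pair.
  have h₂ := goes_subst (ei := h.inputAlphabet) (eo := h.outputAlphabet) (fun _ => s.reverse) w []
    [] true s [] w.reverse true [] hc
  have h₃ := goes_subst (ei := h.inputAlphabet) (eo := h.outputAlphabet)
    (update (fun _ => s.reverse) true []) w [] [] false s [] w.reverse true
    ((substString w true s).map (inputSymbol h.inputAlphabet true)) hc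
  have h₄ := goes_clear (ei := h.inputAlphabet) (eo := h.outputAlphabet) (fun _ => []) w.reverse
    [] [] (single h.tm.k₀ ((substString w false s).map (inputSymbol h.inputAlphabet false) ++
      (substString w true s).map (inputSymbol h.inputAlphabet true)))
  have h₅ := goes_call (ei := h.inputAlphabet) (eo := h.outputAlphabet) (fun _ => []) [] [] [] _ _
    (h.outputsFun (substString w false s, substString w true s))
  have hR : update (fun _ : Bool => s.reverse) true s.reverse = fun _ => s.reverse :=
    update_eq_self ..
  have hR₁ : update (update (fun _ : Bool => s.reverse) true []) false s.reverse =
      update (fun _ : Bool => s.reverse) true [] := by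
    ext1 c; cases c <;> simp
  have hR₂ : update (update (fun _ : Bool => s.reverse) true []) false [] = fun _ => [] := by
    ext1 c; cases c <;> simp
  have hsub : ∀ b, substString w b ([] : List Symbol) = [] := fun b => rfl
  simp only [List.append_nil, hsub, List.map_nil, List.nil_append, hR, hR₁, hR₂, if_true,
    Bool.false_eq_true, if_false] at h₁ h₂ h₃
  rw [single_nil h.tm.k₁ h.tm.k₀] at h₁
  have hin : List.map h.inputAlphabet.invFun ((stringPairEncoding Symbol).encode
      (substString w false s, substString w true s)) =
      (substString w false s).map (inputSymbol h.inputAlphabet false) ++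
        (substString w true s).map (inputSymbol h.inputAlphabet true) := by
    simp [stringPairEncoding, Computability.encodingProd, Computability.encodingList,
      Function.comp_def]
    rfl
  rw [hin] at h₅
  refine ((((h₁.trans h₂).trans h₃).trans h₄).trans h₅).mono ?_
  have hp : h.time.eval ((stringPairEncoding Symbol).encode
      (substString w false s, substString w true s)).length ≤ h.time.eval (2 * N) := by
    -- The encoded pair is a concatenation of two strings of length at most `N`.
    refine polynomial_eval_mono h.time ?_
    have h0 := length_substString_le w false s
    have h1 := length_substString_le w true s
    simp only [stringPairEncoding, Computability.encodingProd, Computability.encodingList, id,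
      List.length_append, List.length_map]
    omega
  have hs : (s.length + 1) * (w.length + 2) ≤ (N + 1) * (N + 2) := by gcongr
  rw [roundTime_eval, List.length_reverse]
  omega

theorem answers_find_of_firstVar_eq_none (s : List Symbol) (hs : firstVar s = none) (N : ℕ)
    (hN : s.length ≤ N) :
    Answers h.inputAlphabet h.outputAlphabet ((roundTime h.time).eval N) (.inl (.find none))
      (contents (fun _ => []) [] [] [] (single h.tm.k₁ (s.map h.outputAlphabet.symm)))
      (evalConst s = some [true]) := by
  have h₁ := goes_find_none (ei := h.inputAlphabet) (eo := h.outputAlphabet) [] [] [] s [] hs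
  have h₂ := answers_eval_true (ei := h.inputAlphabet) (eo := h.outputAlphabet) [] s [] rfl
  have hnil : single h.tm.k₁ [] = fun _ => [] := update_eq_self ..
  simp only [List.append_nil, hnil] at h₁ h₂
  refine (h₁.answers h₂).mono ?_
  -- Copying takes at most `N + 1` steps and evaluating `2 * N + 3`; this is the linear part `3 * N
  -- + 4` of `roundTime`.
  rw [roundTime_eval]
  simp only [List.length_nil]
  omega

/-- Induction on the bound `c` for the letters `x` still present. The length bound `N` stays fixed,
so the time bounds of the rounds add up instead of being composed. -/
theorem answers_find (hf : ∀ a b : List Symbol, f (a, b) ∈ ({a, b} : Set (List Symbol)) ∧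
      ((({a, b} : Set (List Symbol)) ∩ {x | x ∈ SAT}).Nonempty → f (a, b) ∈ SAT))
    (N c : ℕ) (s : List Symbol) (hN : s.length ≤ N) (hc : s.count .x ≤ c) (b : Bool)
    (hb : b = true ↔ s ∈ SAT) :
    Answers h.inputAlphabet h.outputAlphabet ((c + 1) * (roundTime h.time).eval N)
      (.inl (.find none))
      (contents (fun _ => []) [] [] [] (single h.tm.k₁ (s.map h.outputAlphabet.symm))) b := by
  induction c generalizing s with
  | zero =>
    cases hs : firstVar s with
    | some w => exact absurd (count_substString_lt w true s hs) (by omega)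
    | none =>
      obtain rfl : b = decide (evalConst s = some [true]) := by
        rw [Bool.eq_iff_iff, hb, mem_SAT_iff_evalConst s hs, decide_eq_true_iff]
      exact (answers_find_of_firstVar_eq_none h s hs N hN).mono (by simp)
  | succ c ih =>
    cases hs : firstVar s with
    | none =>
      obtain rfl : b = decide (evalConst s = some [true]) := by
        rw [Bool.eq_iff_iff, hb, mem_SAT_iff_evalConst s hs, decide_eq_true_iff]
      exact (answers_find_of_firstVar_eq_none h s hs N hN).mono
        (Nat.le_mul_of_pos_left _ (Nat.succ_pos _))
    | some w =>
      obtain ⟨hmem, hsat⟩ := hf (substString w false s) (substString w true s)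
      have hex : ∃ b', f (substString w false s, substString w true s) = substString w b' s := by
        rcases hmem with hmem | hmem
        exacts [⟨false, hmem⟩, ⟨true, hmem⟩]
      have hiff : s ∈ SAT ↔ f (substString w false s, substString w true s) ∈ SAT := by
        rw [mem_SAT_iff_substString w s]
        constructor
        · rintro (h0 | h1)
          exacts [hsat ⟨_, .inl rfl, h0⟩, hsat ⟨_, .inr rfl, h1⟩]
        · intro h'
          rcases hmem with hmem | hmem
          exacts [.inl (hmem ▸ h'), .inr (hmem ▸ h')]
      have hround := goes_round h s w hs N hN
      obtain ⟨b', hb'⟩ := hex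
      rw [hb'] at hround hiff
      have hcount := count_substString_lt w b' s hs
      refine (hround.answers (ih (substString w b' s) ((length_substString_le w b' s).trans hN)
        (by omega) (hb.trans hiff))).mono (le_of_eq ?_)
      ring

theorem contents_nil :
    contents (fun _ => []) [] [] [] (fun _ => []) = fun _ : OwnStack ⊕ h.tm.K => [] := by
  ext1 k
  rcases k with (_ | _ | _ | _) | _ <;> rfl

/-- The machine that decides satisfiability. -/
def decider : FinTM2 where
  K := OwnStack ⊕ h.tm.K
  kFin := haveI := h.tm.kFin; inferInstance
  k₀ := .inr h.tm.k₁
  k₁ := .inl .out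
  Γ := Alphabet h.tm
  Λ := OwnLabel ⊕ h.tm.Λ
  main := .inl (.find none)
  ΛFin := haveI := h.tm.ΛFin; inferInstance
  σ := Registers × h.tm.σ
  initialState := (Registers.empty, h.tm.initialState)
  σFin := haveI := h.tm.σFin; inferInstance
  Γk₀Fin := Fintype.ofEquiv Symbol h.outputAlphabet.symm
  m := program h.inputAlphabet h.outputAlphabet

/-- The decider takes its input on the selector's output stack, so it starts as if the selector had
just returned the input, and the first round is like any other. -/
theorem initList_decider (x : List (h.tm.Γ h.tm.k₁)) :
    initList (decider h) x = ⟨some (.inl (.find none)), (Registers.empty, h.tm.initialState),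
      contents (fun _ => []) [] [] [] (single h.tm.k₁ x)⟩ := by
  refine (initList_eq (tm := decider h) x).trans (congrArg _ (Eq.trans ?_ (update_contents_inr ..)))
  rw [contents_nil]
  rfl

theorem haltList_decider (b : Bool) :
    haltList (decider h) [b] = ⟨none, (Registers.empty, h.tm.initialState),
      contents (fun _ => []) [] [] [b] (fun _ => [])⟩ := by
  refine (haltList_eq (tm := decider h) [b]).trans
    (congrArg _ (Eq.trans ?_ (update_contents_out (o := []) ..)))
  rw [contents_nil]
  rfl

end SelfReduction

end Complexity

open Complexity Complexity.SelfReduction in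
theorem mainTheorem1 (h : Complexity.PSelective Complexity.SAT) :
    Complexity.InP Complexity.SAT := by
  classical
  obtain ⟨f, ⟨h⟩, hf⟩ := h
  have key : ∀ s, Nonempty (Turing.TM2OutputsInTime (decider h) (s.map h.outputAlphabet.symm)
      (some [decide (s ∈ SAT)]) ((totalTime h.time).eval s.length)) := fun s => by
    -- The input length serves both as length bound and as bound for the number of letters `x`.
    obtain ⟨e⟩ := answers_find h hf s.length s.length s le_rfl List.count_le_length
      (decide (s ∈ SAT)) decide_eq_true_iff Registers.empty
    exact ⟨⟨⟨e.steps, (congrArg (fun c => (flip bind (decider h).step)^[e.steps] (some c))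
      (initList_decider h _)).trans (e.evals_in_steps.trans
        (congrArg some (haltList_decider h _).symm))⟩, e.steps_le_m.trans (by simp [totalTime])⟩⟩
  exact ⟨fun s => decide (s ∈ SAT), ⟨{
    tm := decider h
    inputAlphabet := h.outputAlphabet
    outputAlphabet := Equiv.refl Bool
    time := totalTime h.time
    outputsFun := fun s => (key s).some }⟩, fun s => decide_eq_true_iff⟩
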